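/- Let $K$ be a cubic number field with ring of integers $\mathcal{O}_K$ and discriminant $\Delta(K)$, and let $\mathbf{Q}(\sqrt{\Delta(K)})$ be its quadratic resolvent field. Let $\mathcal{O}_K^\perp=\{3\alpha-\mathrm{tr}(\alpha):\alpha\in\mathcal{O}_K\}$, a free $\mathbf{Z}$-module of rank $2$, where $\mathrm{tr}=\mathrm{Tr}_{K/\mathbf{Q}}$. In any $\mathbf{Z}$-basis $(v_1,v_2)$ of $\mathcal{O}_K^\perp$, the trace-zero form is the integral binary quadratic form $T_K^\perp(x,y)=\mathrm{tr}\big((xv_1+yv_2)^2\big)$, and the primitive trace-zero form $T_K^{\perp\prime}$ is obtained from it by dividing by the greatest common divisor of its coefficients. For $Q(x,y)=rx^2+sxy+ty^2$, write $\Delta(Q)=s^2-4rt$. Suppose that the discriminant of the quadratic resolvent field of $K$ is divisible by $3$. Then $3$ is either wildly or tamely ramified in $K$; it is wildly ramified if and only if $\mathrm{ord}_3\,\Delta(K)\in\{3,5\}$, and tamely ramified if and only if $\mathrm{ord}_3\,\Delta(K)=1$. Moreover, for every choice of $\mathbf{Z}$-basis, $$\mathrm{ord}_3\,\Delta\big(T_K^{\perp\prime}\big)=\begin{cases}0&\text{if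 }3\text{ is wildly ramified in }K,\\ 2&\text{if }3\text{ is tamely ramified in }K.\end{cases}$$ -/

import Mathlib

open Module NumberField

/-- An integral binary quadratic form `r x² + s x y + t y²`. -/
@[ext]
structure IntBinaryQuadForm where
  r : ℤ
  s : ℤ
  t : ℤ

namespace IntBinaryQuadForm

/-- The value `Q(x, y)`. -/
def eval (Q : IntBinaryQuadForm) (x y : ℤ) : ℤ := Q.r * x ^ 2 + Q.s * x * y + Q.t * y ^ 2

/-- The (classical) discriminant `s² - 4 r t`. -/
def disc (Q : IntBinaryQuadForm) : ℤ := Q.s ^ 2 - 4 * Q.r * Q.t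

/-- The greatest common divisor of the three coefficients. -/
def content (Q : IntBinaryQuadForm) : ℕ := Nat.gcd (Int.gcd Q.r Q.s) Q.t.natAbs

/-- The associated primitive form: divide by the gcd of the coefficients (the divisions are
exact). -/
def primitive (Q : IntBinaryQuadForm) : IntBinaryQuadForm where
  r := Q.r / (Q.content : ℤ)
  s := Q.s / (Q.content : ℤ)
  t := Q.t / (Q.content : ℤ)

/-- The binary quadratic form `(x, y) ↦ B (x b₀ + y b₁, x b₀ + y b₁)` of a bilinear form `B`, in
the coordinates given by a basis `(b₀, b₁)`. -/
noncomputable def ofBilin {M : Type*} [AddCommGroup M] (B : LinearMap.BilinForm ℤ M)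
    (b : Basis (Fin 2) ℤ M) : IntBinaryQuadForm where
  r := B (b 0) (b 0)
  s := B (b 0) (b 1) + B (b 1) (b 0)
  t := B (b 1) (b 1)

theorem eval_ofBilin {M : Type*} [AddCommGroup M] (B : LinearMap.BilinForm ℤ M)
    (b : Basis (Fin 2) ℤ M) (x y : ℤ) :
    (ofBilin B b).eval x y = B (x • b 0 + y • b 1) (x • b 0 + y • b 1) := by
  simp only [eval, ofBilin, map_add, map_zsmul, LinearMap.add_apply, LinearMap.smul_apply,
    smul_eq_mul]
  ring

end IntBinaryQuadForm

section CubicFields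

variable (K : Type*) [Field K] [NumberField K]

/-- The perp map `α ↦ n α - tr α` on the ring of integers of a number field of degree `n`. -/
noncomputable def perpMap : 𝓞 K →ₗ[ℤ] 𝓞 K :=
  (finrank ℚ K : ℤ) • LinearMap.id -
    (Algebra.linearMap ℤ (𝓞 K)).comp (Algebra.trace ℤ (𝓞 K))

/-- The lattice `𝓞_K^⊥`: the image of the ring of integers under the perp map. -/
noncomputable def perpLattice : Submodule ℤ (𝓞 K) := LinearMap.range (perpMap K)

/-- The trace-zero form `T_K^⊥`: the pairing on `𝓞_K^⊥` induced by `(α, β) ↦ tr (α β)`. -/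
noncomputable def traceZeroForm : LinearMap.BilinForm ℤ (perpLattice K) :=
  (Algebra.traceForm ℤ (𝓞 K)).restrict (perpLattice K)

/-- For a cubic field, the primitive trace-zero form `T_K^{⊥'}` as a binary quadratic form, written
in a given `ℤ`-basis of `𝓞_K^⊥`. -/
noncomputable def primitiveTraceZeroForm (b : Basis (Fin 2) ℤ (perpLattice K)) :
    IntBinaryQuadForm :=
  (IntBinaryQuadForm.ofBilin (traceZeroForm K) b).primitive

/-- The quadratic resolvent field `ℚ(√Δ(K))`, generated inside `ℂ` by the square roots of the
discriminant of `K`. -/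
noncomputable def quadraticResolvent : IntermediateField ℚ ℂ :=
  IntermediateField.adjoin ℚ {z : ℂ | z ^ 2 = (discr K : ℂ)}

instance : FiniteDimensional ℚ (quadraticResolvent K) := by
  obtain ⟨w, hw⟩ := IsAlgClosed.exists_pow_nat_eq (discr K : ℂ) (n := 2) (by norm_num)
  have hfin : Finite {z : ℂ | z ^ 2 = (discr K : ℂ)} := by
    apply Set.Finite.subset (Set.toFinite {w, -w})
    intro z hz
    have h : z ^ 2 = w ^ 2 := by rw [hw]; exact hz
    rcases sq_eq_sq_iff_eq_or_eq_neg.1 h with h | h <;> simp [h]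
  refine IntermediateField.finiteDimensional_adjoin fun z hz => ?_
  refine IsIntegral.of_pow (n := 2) (by norm_num) ?_
  rw [show z ^ 2 = algebraMap ℚ ℂ (discr K : ℚ) by simpa using hz]
  exact isIntegral_algebraMap

instance : NumberField (quadraticResolvent K) where
  to_charZero := inferInstance
  to_finiteDimensional := inferInstance

/-- The rational prime `p` is wildly ramified in `K`: it divides the ramification index of some
prime above it. -/
def IsWildlyRamified (p : ℕ) : Prop :=
  ∃ P ∈ (Ideal.span {(p : ℤ)}).primesOver (𝓞 K), p ∣ P.ramificationIdx ℤ

/-- The rational prime `p` is tamely ramified in `K`: it ramifies, and it divides no ramification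
index of a prime above it. (Residue field extensions are finite extensions of finite fields, so
their separability is automatic.) -/
def IsTamelyRamified (p : ℕ) : Prop :=
  (∃ P ∈ (Ideal.span {(p : ℤ)}).primesOver (𝓞 K), 1 < P.ramificationIdx ℤ) ∧
    ∀ P ∈ (Ideal.span {(p : ℤ)}).primesOver (𝓞 K), ¬ p ∣ P.ramificationIdx ℤ

/-- For a cubic field, `𝓞_K^⊥` is free of rank two. -/
theorem nonempty_basis_perpLattice (hK : finrank ℚ K = 3) :
    Nonempty (Basis (Fin 2) ℤ (perpLattice K)) := by
  have h1 : finrank ℤ (𝓞 K) = 3 := by rw [RingOfIntegers.rank, hK]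
  have hker : LinearMap.ker (perpMap K) = Submodule.span ℤ {(1 : 𝓞 K)} := by
    refine le_antisymm (fun x hx => ?_) ?_
    · have hx' : (3 : ℤ) • x - algebraMap ℤ (𝓞 K) (Algebra.trace ℤ (𝓞 K) x) = 0 := by
        simpa [perpMap, hK] using hx
      generalize Algebra.trace ℤ (𝓞 K) x = m at hx'
      have h3x : (3 : K) * (x : K) = (m : K) := by
        have h := congrArg (algebraMap (𝓞 K) K) hx'
        rw [map_sub, map_zsmul, map_zero, sub_eq_zero, zsmul_eq_mul] at h
        simpa using h
      have hq : (x : K) = algebraMap ℚ K ((m : ℚ) / 3) := by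
        rw [map_div₀, eq_div_iff (by simp)]
        simp [← h3x, mul_comm]
      have hint : IsIntegral ℤ ((m : ℚ) / 3) := by
        rw [← isIntegral_algebraMap_iff (algebraMap ℚ K).injective, ← hq]
        exact x.isIntegral_coe
      obtain ⟨k, hk⟩ := IsIntegrallyClosed.isIntegral_iff.1 hint
      refine Submodule.mem_span_singleton.2 ⟨k, ?_⟩
      apply RingOfIntegers.coe_injective
      refine Eq.trans ?_ hq.symm
      rw [← hk]
      simp
    · rw [Submodule.span_singleton_le_iff_mem, LinearMap.mem_ker]
      have h := Algebra.trace_algebraMap (R := ℤ) (S := 𝓞 K) 1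
      rw [map_one, h1] at h
      change (finrank ℚ K : ℤ) • (1 : 𝓞 K) -
        algebraMap ℤ (𝓞 K) (Algebra.trace ℤ (𝓞 K) 1) = 0
      rw [h, hK, nsmul_one, zsmul_one, sub_eq_zero]
      simp
  have h2 : finrank ℤ (LinearMap.ker (perpMap K)) = 1 := by
    rw [hker, ← (LinearEquiv.toSpanNonzeroSingleton ℤ (𝓞 K) 1 one_ne_zero).finrank_eq]
    exact finrank_self ℤ
  have h3 := Submodule.finrank_quotient_add_finrank (LinearMap.ker (perpMap K))
  rw [h1, h2, (perpMap K).quotKerEquivRange.finrank_eq] at h3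
  have h4 : finrank ℤ (perpLattice K) = 2 := Nat.add_right_cancel h3
  exact ⟨finBasisOfFinrankEq ℤ _ h4⟩

end CubicFields

/-! By Delone and Faddeev, the ring of integers has a basis `1, ω, θ` whose multiplication table is
read off a binary cubic form `(a, b, c, d)` of discriminant Δ(K). The trace-zero form is 6 times the
Hessian `(b² - 3ac, bc - 9ad, c² - 3bd)` and has discriminant -108 Δ(K). Everything thus reduces to
3-adic orders of `a, b, c, d`.

As 3 divides Δ(K), the cubic form has a double root modulo 3, which can be moved so that 3 divides
`c` and `d` (`exists_dvd`). Wild ramification means that the root is triple, i.e. that 3 divides `b`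
(`isWildlyRamified_iff`). Maximality of the ring excludes 9 ∣ `d`, and also 3 ∣ `a` when 3 ∣ `b`
(`not_dvd_of_isIntegrallyClosed`).

If 3 ∤ `b`, then Δ(K) ≡ -4b³d modulo 9 has order 1. The trace-zero form has discriminant of order 4
and content of order 1, which leaves 2. If 3 ∣ `b`, the order of Δ(K) is 3, 4 or 5, and the
resolvent excludes 4 because it forces an odd order (`three_dvd_of_discr_eq_sq_mul`). The content
then has order 3 or 4, which uses up the whole order 6 or 8 of -108 Δ(K). -/

/-- The elements `1, ω, θ` form a `ℤ`-basis of `A`. -/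
structure IsIntBasis {A : Type*} [CommRing A] (ω θ : A) : Prop where
  span : ∀ α : A, ∃ z x y : ℤ, α = z + x * ω + y * θ
  indep : ∀ z x y : ℤ, (z + x * ω + y * θ : A) = 0 → z = 0 ∧ x = 0 ∧ y = 0

/-- The elements `1, ω, θ` form a `ℤ`-basis of `A` with the multiplication table attached by Delone
and Faddeev to the binary cubic form `a x³ + b x² y + c x y² + d y³`. -/
structure IsCubicBasis {A : Type*} [CommRing A] (ω θ : A) (a b c d : ℤ) : Prop
    extends IsIntBasis ω θ where
  mul : ω * θ = -(a * d)
  sq_left : ω ^ 2 = -(a * c) + b * ω - a * θ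
  sq_right : θ ^ 2 = -(b * d) + d * ω - c * θ

/-- The discriminant of the binary cubic form `a x³ + b x² y + c x y² + d y³`. -/
def cubicDisc {R : Type*} [CommRing R] (a b c d : R) : R :=
  b ^ 2 * c ^ 2 - 4 * a * c ^ 3 - 4 * b ^ 3 * d - 27 * a ^ 2 * d ^ 2 + 18 * a * b * c * d

/-! ### Bases of cubic rings and binary cubic forms -/

namespace IsIntBasis

variable {A : Type*} [CommRing A] {ω θ : A}

theorem ext (h : IsIntBasis ω θ) {z x y z' x' y' : ℤ}
    (e : (z + x * ω + y * θ : A) = z' + x' * ω + y' * θ) : z = z' ∧ x = x' ∧ y = y' := by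
  have := h.indep (z - z') (x - x') (y - y') (by push_cast; linear_combination e)
  omega

theorem swap (h : IsIntBasis ω θ) : IsIntBasis θ ω where
  span α := by
    obtain ⟨z, x, y, e⟩ := h.span α
    exact ⟨z, y, x, by rw [e]; ring⟩
  indep z x y e := by
    have := h.indep z y x (by linear_combination e)
    omega

theorem shift (h : IsIntBasis ω θ) (k m n : ℤ) : IsIntBasis (ω + m) (θ + k * ω + n) where
  span α := by
    obtain ⟨z, x, y, e⟩ := h.span α
    refine ⟨z - (x - k * y) * m - y * n, x - k * y, y, ?_⟩
    rw [e]; push_cast; ring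
  indep z x y e := by
    have := h.indep (z + x * m + y * n) (x + k * y) y (by push_cast; linear_combination e)
    obtain ⟨h1, h2, rfl⟩ := this
    obtain rfl : x = 0 := by simpa using h2
    simpa using h1

/-- Every `ℤ`-basis `1, ω, θ` can be translated to one with a Delone–Faddeev table. -/
theorem exists_isCubicBasis (h : IsIntBasis ω θ) :
    ∃ (ω' θ' : A) (a b c d : ℤ), IsCubicBasis ω' θ' a b c d := by
  obtain ⟨n, m₁, m₂, e⟩ := h.span (ω * θ)
  -- Since ωθ = n + m₁ω + m₂θ, this translation makes the product the integer n + m₁m₂.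
  have h' := h.shift 0 (-m₂) (-m₁)
  set ω' := ω + (-m₂ : ℤ) with hω
  set θ' := θ + (0 : ℤ) * ω + (-m₁ : ℤ) with hθ
  have e' : ω' * θ' = ((n + m₁ * m₂ : ℤ) : A) := by
    rw [hω, hθ]; push_cast; linear_combination e
  obtain ⟨l, b, a, e₁⟩ := h'.span (ω' ^ 2)
  obtain ⟨k, d, c, e₂⟩ := h'.span (θ' ^ 2)
  generalize n + m₁ * m₂ = p at e'
  -- Associativity determines the constant terms: compare coefficients in ω'²·θ' = ω'·(ω'θ'), then
  -- in θ'²·ω' = θ'·(ω'θ').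
  have r₁ := h'.ext (z := b * p + a * k) (x := a * d) (y := l + a * c) (z' := 0) (x' := p) (y' := 0)
    (by push_cast; linear_combination ω' * e' - θ' * e₁ - a * e₂ - b * e')
  have r₂ := h'.ext (z := d * l + c * p) (x := k + d * b) (y := d * a) (z' := 0) (x' := 0) (y' := p)
    (by push_cast; linear_combination θ' * e' - ω' * e₂ - d * e₁ - c * e')
  refine ⟨ω', θ', -a, b, -c, d, h', ?_, ?_, ?_⟩
  · rw [e', ← r₁.2.1]; push_cast; ring
  · rw [e₁, show l = -(a * c) by linarith [r₁.2.2]]; push_cast; ring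
  · rw [e₂, show k = -(d * b) by linarith [r₂.2.1]]; push_cast; ring

/-- The `ℤ`-basis `1, ω, θ` as a `Basis`. -/
noncomputable def basis (h : IsIntBasis ω θ) : Basis (Fin 3) ℤ A :=
  Basis.mk (v := ![1, ω, θ])
    (by
      rw [Fintype.linearIndependent_iff]
      intro g hg
      have := h.indep (g 0) (g 1) (g 2) (by simpa [Fin.sum_univ_three] using hg)
      intro i
      fin_cases i <;> simp [this])
    (by
      intro α _
      obtain ⟨z, x, y, e⟩ := h.span α
      rw [Submodule.mem_span_range_iff_exists_fun]
      exact ⟨![z, x, y], by simp [Fin.sum_univ_three, e]⟩)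

theorem coe_basis (h : IsIntBasis ω θ) : ⇑h.basis = ![1, ω, θ] := by
  simp [basis]

theorem repr_basis (h : IsIntBasis ω θ) (z x y : ℤ) :
    ⇑(h.basis.repr (z + x * ω + y * θ)) = ![z, x, y] := by
  have : (z + x * ω + y * θ : A) = ∑ i, (![z, x, y] : Fin 3 → ℤ) i • h.basis i := by
    simp [Fin.sum_univ_three, coe_basis]
  rw [this, Basis.repr_sum_self]

theorem trace_intCast (h : IsIntBasis ω θ) (n : ℤ) : Algebra.trace ℤ A n = 3 * n := by
  have := Algebra.trace_algebraMap_of_basis h.basis n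
  simpa using this

end IsIntBasis

namespace IsCubicBasis

variable {A : Type*} [CommRing A] {ω θ : A} {a b c d : ℤ}

theorem swap (h : IsCubicBasis ω θ a b c d) : IsCubicBasis θ ω (-d) (-c) (-b) (-a) where
  toIsIntBasis := h.toIsIntBasis.swap
  mul := by push_cast; linear_combination h.mul
  sq_left := by push_cast; linear_combination h.sq_right
  sq_right := by push_cast; linear_combination h.sq_left

/-- This is the substitution x ↦ x + ky in the cubic form; the added constants keep the product of
the two generators an integer. -/
theorem shift (h : IsCubicBasis ω θ a b c d) (k : ℤ) :
    IsCubicBasis (ω + (k * a : ℤ)) (θ + k * ω + (-(k * b + k ^ 2 * a) : ℤ))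
      a (b + 3 * k * a) (c + 2 * k * b + 3 * k ^ 2 * a)
      (d + k * c + k ^ 2 * b + k ^ 3 * a) where
  toIsIntBasis := h.toIsIntBasis.shift ..
  mul := by push_cast; linear_combination h.mul + k * h.sq_left
  sq_left := by push_cast; linear_combination h.sq_left
  sq_right := by push_cast; linear_combination h.sq_right + 2 * k * h.mul + k ^ 2 * h.sq_left

/-- If `3` divides the discriminant, then the double root of the cubic form modulo `3` can be moved
to `(0 : 1)`. -/
theorem exists_dvd (h : IsCubicBasis ω θ a b c d) (hD : (3 : ℤ) ∣ cubicDisc a b c d) :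
    ∃ (ω' θ' : A) (a' b' c' d' : ℤ), IsCubicBasis ω' θ' a' b' c' d' ∧ 3 ∣ c' ∧ 3 ∣ d' := by
  -- A double root over 𝔽₃ is rational: it is (1 : 0), handled by `swap`, or (k : 1), handled by
  -- `shift`.
  have key : ∀ a b c d : ZMod 3, cubicDisc a b c d = 0 →
      (a = 0 ∧ b = 0) ∨ ∃ k : ZMod 3, c + 2 * k * b + 3 * k ^ 2 * a = 0 ∧
        d + k * c + k ^ 2 * b + k ^ 3 * a = 0 := by
    unfold cubicDisc; decide
  have h3 (n : ℤ) : (3 : ℤ) ∣ n ↔ (n : ZMod 3) = 0 := (ZMod.intCast_zmod_eq_zero_iff_dvd n 3).symm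
  rw [h3] at hD
  rcases key a b c d (by simpa [cubicDisc] using hD) with ⟨ha, hb⟩ | ⟨k, hc, hd⟩
  · exact ⟨_, _, _, _, _, _, h.swap, by simpa [h3] using hb, by simpa [h3] using ha⟩
  · obtain ⟨k, rfl⟩ := ZMod.intCast_surjective k
    exact ⟨_, _, _, _, _, _, h.shift k, by rw [h3]; exact_mod_cast hc,
      by rw [h3]; exact_mod_cast hd⟩

theorem cubic_eq_zero (h : IsCubicBasis ω θ a b c d) :
    θ ^ 3 + c * θ ^ 2 + (b * d : ℤ) * θ + (a * d ^ 2 : ℤ) = 0 := by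
  push_cast
  linear_combination θ * h.sq_right + d * h.mul

theorem trace_left (h : IsCubicBasis ω θ a b c d) : Algebra.trace ℤ A ω = b := by
  rw [Algebra.trace_eq_matrix_trace h.basis]
  simp only [Matrix.trace, Matrix.diag, Algebra.leftMulMatrix_eq_repr_mul, Fin.sum_univ_three,
    h.coe_basis]
  -- The diagonal entries of multiplication by ω come from ω·1, ω·ω and ω·θ: they are 0, b and 0.
  have e₀ := h.repr_basis 0 1 0
  have e₁ := h.repr_basis (-(a * c)) b (-a)
  have e₂ := h.repr_basis (-(a * d)) 0 0
  rw [show ((0 : ℤ) + (1 : ℤ) * ω + (0 : ℤ) * θ : A) = ω * 1 by push_cast; ring] at e₀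
  rw [show ((-(a * c) : ℤ) + b * ω + (-a : ℤ) * θ : A) = ω * ω by
    push_cast; linear_combination -h.sq_left] at e₁
  rw [show ((-(a * d) : ℤ) + (0 : ℤ) * ω + (0 : ℤ) * θ : A) = ω * θ by
    push_cast; linear_combination -h.mul] at e₂
  simp [-mul_one, e₀, e₁, e₂]

theorem trace_right (h : IsCubicBasis ω θ a b c d) : Algebra.trace ℤ A θ = -c :=
  h.swap.trace_left

theorem trace_add (h : IsCubicBasis ω θ a b c d) (z x y : ℤ) :
    Algebra.trace ℤ A (z + x * ω + y * θ) = 3 * z + x * b - y * c := by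
  simp only [← zsmul_eq_mul, map_add, map_zsmul, h.trace_left, h.trace_right, h.trace_intCast]
  simp; ring

theorem trace_sq_left (h : IsCubicBasis ω θ a b c d) :
    Algebra.trace ℤ A (ω * ω) = b ^ 2 - 2 * a * c := by
  have := h.trace_add (-(a * c)) b (-a)
  rw [show ((-(a * c) : ℤ) + b * ω + (-a : ℤ) * θ : A) = ω * ω by
    push_cast; linear_combination -h.sq_left] at this
  rw [this]; ring

theorem trace_sq_right (h : IsCubicBasis ω θ a b c d) :
    Algebra.trace ℤ A (θ * θ) = c ^ 2 - 2 * b * d := by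
  rw [h.swap.trace_sq_left]; ring

theorem trace_mul (h : IsCubicBasis ω θ a b c d) :
    Algebra.trace ℤ A (ω * θ) = -3 * a * d := by
  rw [h.mul]
  have := h.trace_intCast (-(a * d))
  push_cast at this
  rw [this]; ring

end IsCubicBasis

theorem NumberField.discr_eq_of_isIntBasis {K : Type*} [Field K] [NumberField K] {ω θ : 𝓞 K}
    (h : IsIntBasis ω θ) :
    discr K = Matrix.det !![3, Algebra.trace ℤ (𝓞 K) ω, Algebra.trace ℤ (𝓞 K) θ;
      Algebra.trace ℤ (𝓞 K) ω, Algebra.trace ℤ (𝓞 K) (ω * ω), Algebra.trace ℤ (𝓞 K) (ω * θ);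
      Algebra.trace ℤ (𝓞 K) θ, Algebra.trace ℤ (𝓞 K) (ω * θ), Algebra.trace ℤ (𝓞 K) (θ * θ)] := by
  rw [← discr_eq_discr K h.basis, Algebra.discr_def]
  congr 1
  have := h.trace_intCast 1
  simp only [Int.cast_one] at this
  ext i j
  fin_cases i <;> fin_cases j <;>
    simp [Algebra.traceMatrix_apply, Algebra.traceForm_apply, h.coe_basis, this, mul_comm θ ω]

theorem IsCubicBasis.discr_eq {K : Type*} [Field K] [NumberField K] {ω θ : 𝓞 K} {a b c d : ℤ}
    (h : IsCubicBasis ω θ a b c d) : discr K = cubicDisc a b c d := by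
  rw [discr_eq_of_isIntBasis h.toIsIntBasis, h.trace_left, h.trace_right, h.trace_sq_left,
    h.trace_sq_right, h.trace_mul, Matrix.det_fin_three]
  simp [cubicDisc]
  ring

/-! ### Ramification and the primes above 3 -/

section Ramification

variable (K : Type*) [Field K]

theorem mem_primesOver_span_iff {p : ℤ} (hp : Prime p) (P : Ideal (𝓞 K)) :
    P ∈ (Ideal.span {p}).primesOver (𝓞 K) ↔ P.IsPrime ∧ (p : 𝓞 K) ∈ P := by
  refine ⟨fun h => ⟨h.1, ?_⟩, fun h => ⟨h.1, ?_⟩⟩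
  · have := (Ideal.liesOver_span_iff h.1.ne_top hp).1 h.2
    simpa using this
  · exact (Ideal.liesOver_span_iff h.1.ne_top hp).2 (by simpa using h.2)

variable [NumberField K]

/-- A prime dividing the discriminant has a ramified prime ideal above it. -/
theorem exists_one_lt_ramificationIdx {p : ℤ} (hp : Prime p) (h : p ∣ discr K) :
    ∃ P ∈ (Ideal.span {p}).primesOver (𝓞 K), 1 < P.ramificationIdx ℤ := by
  have := mt (not_dvd_discr_iff_forall_mem K (𝓞 K) hp).2 (not_not.2 h)
  push Not at this
  obtain ⟨P, hP, hpP, hu⟩ := this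
  have hmem := (mem_primesOver_span_iff K hp P).2 ⟨hP, hpP⟩
  refine ⟨P, hmem, ?_⟩
  have : P.LiesOver (Ideal.span {p}) := hmem.2
  have : (P.under ℤ).IsMaximal := by
    rw [← Ideal.over_def P (Ideal.span {p})]
    exact PrincipalIdealRing.isMaximal_of_irreducible hp.irreducible
  have hne : P.under ℤ ≠ ⊥ := by
    rw [← Ideal.over_def P (Ideal.span {p})]
    simpa using hp.ne_zero
  have : Finite (ℤ ⧸ P.under ℤ) := Ideal.finiteQuotientOfFreeOfNeBot _ hne
  have : Finite (P.under ℤ).ResidueField :=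
    Finite.of_surjective _ (Ideal.bijective_algebraMap_quotient_residueField (P.under ℤ)).2
  have h1 : P.ramificationIdx ℤ ≠ 1 := fun h1 => hu (Ideal.ramificationIdx_eq_one_iff.1 h1)
  have := P.ramificationIdx_pos ℤ
  omega

theorem ramificationIdx_mul_inertiaDeg_of_unique {p : ℤ} (hp : Prime p) {P : Ideal (𝓞 K)}
    (hP : P ∈ (Ideal.span {p}).primesOver (𝓞 K))
    (huniq : ∀ Q ∈ (Ideal.span {p}).primesOver (𝓞 K), Q = P) :
    P.ramificationIdx ℤ * P.inertiaDeg ℤ = finrank ℚ K := by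
  have : (Ideal.span {p}).IsPrime := (Ideal.span_singleton_prime hp.ne_zero).2 hp
  let : Unique ((Ideal.span {p}).primesOver (𝓞 K)) :=
    ⟨⟨⟨P, hP⟩⟩, fun Q => Subtype.ext (huniq _ Q.2)⟩
  have := Ideal.sum_ramification_inertia_eq_finrank (Ideal.span {p}) (𝓞 K)
  rw [RingOfIntegers.rank] at this
  rw [← this]
  simp
  rfl

/-- A second prime would contribute at least 1 more to ∑ e f, which equals the degree. -/
theorem eq_of_finrank_le_ramificationIdx {p : ℤ} (hp : Prime p) {P Q : Ideal (𝓞 K)}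
    (hP : P ∈ (Ideal.span {p}).primesOver (𝓞 K)) (hQ : Q ∈ (Ideal.span {p}).primesOver (𝓞 K))
    (he : finrank ℚ K ≤ P.ramificationIdx ℤ) : Q = P := by
  classical
  have : (Ideal.span {p}).IsPrime := (Ideal.span_singleton_prime hp.ne_zero).2 hp
  have : (Ideal.span {p}).IsMaximal := PrincipalIdealRing.isMaximal_of_irreducible hp.irreducible
  have : Finite ((Ideal.span {p}).primesOver (𝓞 K)) :=
    IsDedekindDomain.primesOver_finite (Ideal.span {p}) (𝓞 K)
  let := Fintype.ofFinite ((Ideal.span {p}).primesOver (𝓞 K))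
  have hsum := Ideal.sum_ramification_inertia_eq_finrank (Ideal.span {p}) (𝓞 K)
  rw [RingOfIntegers.rank] at hsum
  by_contra hne
  have hne' : (⟨Q, hQ⟩ : (Ideal.span {p}).primesOver (𝓞 K)) ≠ ⟨P, hP⟩ := by simpa using hne
  have hle := Finset.sum_le_sum_of_subset (f := fun q : (Ideal.span {p}).primesOver (𝓞 K) =>
    q.1.ramificationIdx ℤ * q.1.inertiaDeg ℤ) (Finset.subset_univ {⟨Q, hQ⟩, ⟨P, hP⟩})
  rw [hsum, Finset.sum_pair hne'] at hle
  have := hP.1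
  have := hQ.1
  have := Nat.mul_pos (Q.ramificationIdx_pos ℤ) (Q.inertiaDeg_pos ℤ)
  have := Nat.le_mul_of_pos_right (P.ramificationIdx ℤ) (P.inertiaDeg_pos ℤ)
  simp only at hle
  omega

/-- Such an element is nilpotent modulo p, so its trace is nilpotent in the field ℤ/p. -/
theorem dvd_trace_of_forall_mem {p : ℤ} (hp : Prime p) {x : 𝓞 K}
    (hx : ∀ P ∈ (Ideal.span {p}).primesOver (𝓞 K), x ∈ P) : p ∣ Algebra.trace ℤ (𝓞 K) x := by
  have : (Ideal.span {p}).IsMaximal := PrincipalIdealRing.isMaximal_of_irreducible hp.irreducible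
  have hrad : x ∈ (Ideal.map (algebraMap ℤ (𝓞 K)) (Ideal.span {p})).radical := by
    rw [Ideal.radical_eq_sInf, Ideal.mem_sInf]
    intro P hP
    refine hx P ((mem_primesOver_span_iff K hp P).2 ⟨hP.2, hP.1 ?_⟩)
    simpa using Ideal.mem_map_of_mem (algebraMap ℤ (𝓞 K)) (Ideal.mem_span_singleton_self p)
  obtain ⟨n, hn⟩ := hrad
  rw [← Ideal.mem_span_singleton, ← Ideal.Quotient.eq_zero_iff_mem,
    ← Algebra.intTrace_eq_trace, ← Algebra.trace_quotient_eq_of_isDedekindDomain,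
    ← isNilpotent_iff_eq_zero]
  refine Algebra.isNilpotent_trace_of_isNilpotent ⟨n, ?_⟩
  rw [← map_pow, Ideal.Quotient.eq_zero_iff_mem]
  exact hn

end Ramification

theorem IsIntBasis.finrank_eq_three {K : Type*} [Field K] [NumberField K] {ω θ : 𝓞 K}
    (h : IsIntBasis ω θ) : finrank ℚ K = 3 := by
  rw [← RingOfIntegers.rank, finrank_eq_card_basis h.basis, Fintype.card_fin]

namespace IsCubicBasis

variable {K : Type*} [Field K] {ω θ : 𝓞 K} {a b c d : ℤ}

theorem right_mem (h : IsCubicBasis ω θ a b c d) (hc : 3 ∣ c) (hd : 3 ∣ d) {P : Ideal (𝓞 K)}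
    (hP : P.IsPrime) (h3 : (3 : 𝓞 K) ∈ P) : θ ∈ P := by
  obtain ⟨c, rfl⟩ := hc
  obtain ⟨d, rfl⟩ := hd
  refine hP.mem_of_pow_mem 2 ?_
  rw [h.sq_right, show (-(b * (3 * d : ℤ)) + (3 * d : ℤ) * ω - (3 * c : ℤ) * θ : 𝓞 K) =
    (-(b * d) + d * ω - c * θ) * 3 by push_cast; ring]
  exact P.mul_mem_left _ h3

theorem left_mem_or (h : IsCubicBasis ω θ a b c d) (hc : 3 ∣ c) (hd : 3 ∣ d) {P : Ideal (𝓞 K)}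
    (hP : P.IsPrime) (h3 : (3 : 𝓞 K) ∈ P) : ω ∈ P ∨ ω - b ∈ P := by
  refine hP.mem_or_mem ?_
  have hθ := h.right_mem hc hd hP h3
  obtain ⟨c, rfl⟩ := hc
  rw [show ω * (ω - b) = (-(a * c)) * 3 - a * θ by
    have := h.sq_left
    push_cast at this
    linear_combination this]
  exact P.sub_mem (P.mul_mem_left _ h3) (P.mul_mem_left _ hθ)

variable [NumberField K]

theorem isWildlyRamified_iff (h : IsCubicBasis ω θ a b c d) (hc : 3 ∣ c) (hd : 3 ∣ d) :
    IsWildlyRamified K 3 ↔ 3 ∣ b := by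
  have hrank := h.toIsIntBasis.finrank_eq_three
  have hp : Prime (3 : ℤ) := Int.prime_three
  constructor
  · rintro ⟨P, hP, he⟩
    simp only [Nat.cast_ofNat] at hP
    have hPp := hP.1
    have he' := Nat.le_of_dvd (P.ramificationIdx_pos ℤ) he
    have huniq : ∀ Q ∈ (Ideal.span {(3 : ℤ)}).primesOver (𝓞 K), Q = P := fun Q hQ =>
      -- As 3 divides e, it is at least the degree, so P is the only prime above 3. Then ω or ω - b
      -- lies in every such prime, and 3 divides its trace, b or b - 3b = -2b.
      eq_of_finrank_le_ramificationIdx K hp hP hQ (by omega)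
    have h3 := ((mem_primesOver_span_iff K hp P).1 hP).2
    rcases h.left_mem_or hc hd hPp (by simpa using h3) with hω | hω
    · have := dvd_trace_of_forall_mem K hp (x := ω) fun Q hQ => by rwa [huniq Q hQ]
      rwa [h.trace_left] at this
    · have := dvd_trace_of_forall_mem K hp (x := ω - b) fun Q hQ => by rwa [huniq Q hQ]
      rw [map_sub, h.trace_left, h.trace_intCast] at this
      omega
  · intro hb
    have h3D : (3 : ℤ) ∣ discr K := by
      rw [h.discr_eq, cubicDisc]
      obtain ⟨c, rfl⟩ := hc
      obtain ⟨d, rfl⟩ := hd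
      exact ⟨3 * b ^ 2 * c ^ 2 - 36 * a * c ^ 3 - 4 * b ^ 3 * d - 81 * a ^ 2 * d ^ 2 +
        54 * a * b * c * d, by ring⟩
    obtain ⟨P, hP, he⟩ := exists_one_lt_ramificationIdx K hp h3D
    -- Every prime above 3 contains 3, ω and θ, so there is only one. Then e f = 3 with e > 1 gives
    -- e = 3.
    have key : ∀ Q ∈ (Ideal.span {(3 : ℤ)}).primesOver (𝓞 K), ∀ z x y : ℤ,
        (z + x * ω + y * θ : 𝓞 K) ∈ Q ↔ 3 ∣ z := by
      intro Q hQ z x y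
      have hQp := hQ.1
      have h3 : (3 : 𝓞 K) ∈ Q := by simpa using ((mem_primesOver_span_iff K hp Q).1 hQ).2
      have hθ := h.right_mem hc hd hQp h3
      have hω : ω ∈ Q := by
        rcases h.left_mem_or hc hd hQp h3 with hω | hω
        · exact hω
        · obtain ⟨b, rfl⟩ := hb
          simpa [mul_comm] using Q.add_mem hω (Q.mul_mem_left (b : 𝓞 K) h3)
      rw [Q.add_mem_iff_left (Q.mul_mem_left _ hθ), Q.add_mem_iff_left (Q.mul_mem_left _ hω)]
      have : Q.LiesOver (Ideal.span {(3 : ℤ)}) := hQ.2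
      rw [← Ideal.mem_span_singleton, Ideal.mem_of_liesOver Q (Ideal.span {(3 : ℤ)})]
      simp
    have huniq : ∀ Q ∈ (Ideal.span {(3 : ℤ)}).primesOver (𝓞 K), Q = P := by
      intro Q hQ
      ext α
      obtain ⟨z, x, y, rfl⟩ := h.span α
      rw [key Q hQ, key P hP]
    refine ⟨P, by simpa using hP, ?_⟩
    have := ramificationIdx_mul_inertiaDeg_of_unique K hp hP huniq
    rw [hrank] at this
    rcases (Nat.dvd_prime Nat.prime_three).1 (Dvd.intro _ this) with h1 | h1
    · omega
    · rw [h1]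

end IsCubicBasis

/-! ### The discriminant of the quadratic resolvent -/

/-- A prime dividing the discriminant of a number field generated by a square root of `m` divides
`4 m`. -/
theorem NumberField.dvd_of_dvd_discr_of_sq_eq {L : Type*} [Field L] [NumberField L] {p m : ℤ}
    (hp : Prime p) {x : 𝓞 L} (hx : x ^ 2 = m) (htop : Algebra.adjoin ℚ {(x : L)} = ⊤)
    (hL : p ∣ discr L) : p ∣ 4 * m := by
  have := mt (not_dvd_discr_iff_forall_mem L (𝓞 L) hp).2 (not_not.2 hL)
  push Not at this
  obtain ⟨P, hP, hpP, hu⟩ := this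
  -- A ramified P divides the different, which contains f'(x) for f the minimal polynomial of x. As
  -- f divides X² - m, the element 2x is a multiple of f'(x).
  have hdiff := Ideal.dvd_iff_le.1 (dvd_differentIdeal_iff.2 hu)
    (aeval_derivative_mem_differentIdeal ℤ ℚ L x htop)
  have hroot : Polynomial.aeval x (Polynomial.X ^ 2 - Polynomial.C m : Polynomial ℤ) = 0 := by
    simp [hx]
  obtain ⟨g, hg⟩ := minpoly.isIntegrallyClosed_dvd (Algebra.IsIntegral.isIntegral (R := ℤ) x) hroot
  have h2 : 2 * x = Polynomial.aeval x (Polynomial.derivative (minpoly ℤ x)) *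
      Polynomial.aeval x g := by
    have := congrArg (fun f => Polynomial.aeval x (Polynomial.derivative f)) hg
    simpa [Polynomial.derivative_mul, one_add_one_eq_two, map_ofNat] using this
  have h2x : 2 * x ∈ P := h2 ▸ P.mul_mem_right _ hdiff
  have h4 : ((4 * m : ℤ) : 𝓞 L) ∈ P := by
    rw [show ((4 * m : ℤ) : 𝓞 L) = 2 * x * (2 * x) by push_cast; rw [← hx]; ring]
    exact P.mul_mem_left _ h2x
  have : P.LiesOver (Ideal.span {p}) := ((mem_primesOver_span_iff L hp P).2 ⟨hP, hpP⟩).2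
  rw [← Ideal.mem_span_singleton, Ideal.mem_of_liesOver P (Ideal.span {p})]
  simpa using h4

/-- If `3` divides the discriminant of the quadratic resolvent of `K`, then it divides the
discriminant of `K` to an odd power. -/
theorem three_dvd_of_discr_eq_sq_mul (K : Type*) [Field K] [NumberField K]
    (hres : (3 : ℤ) ∣ discr (quadraticResolvent K)) {n m : ℤ} (hD : discr K = n ^ 2 * m) :
    3 ∣ m := by
  obtain ⟨w, hw⟩ := IsAlgClosed.exists_pow_nat_eq (m : ℂ) (n := 2) (by norm_num)
  have hn : n ≠ 0 := by
    rintro rfl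
    exact discr_ne_zero K (by simpa using hD)
  have hn' : (n : ℂ) ≠ 0 := by exact_mod_cast hn
  have hDC : (discr K : ℂ) = n ^ 2 * m := by exact_mod_cast congrArg (Int.cast : ℤ → ℂ) hD
  have hmem : w ∈ quadraticResolvent K := by
    have h1 : (n : ℂ) * w ∈ quadraticResolvent K :=
      IntermediateField.subset_adjoin _ _ (by simp [mul_pow, hw, hDC])
    have h2 := mul_mem (inv_mem (intCast_mem (quadraticResolvent K) n)) h1
    rwa [inv_mul_cancel_left₀ hn'] at h2
  have hle : quadraticResolvent K = IntermediateField.adjoin ℚ {w} := by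
    refine le_antisymm (IntermediateField.adjoin_le_iff.2 fun z hz => ?_)
      (IntermediateField.adjoin_le_iff.2 (by simpa using hmem))
    have hz' : z ^ 2 = (n * w) ^ 2 := by rw [mul_pow, hw, ← hDC]; exact hz
    have hnw : (n : ℂ) * w ∈ IntermediateField.adjoin ℚ {w} :=
      mul_mem (intCast_mem _ n) (IntermediateField.mem_adjoin_simple_self ℚ w)
    rcases sq_eq_sq_iff_eq_or_eq_neg.1 hz' with rfl | rfl
    · exact hnw
    · exact neg_mem hnw
  let x' : quadraticResolvent K := ⟨w, hmem⟩
  have hx' : x' ^ 2 = m := Subtype.ext (by simpa [x'] using hw)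
  have hint : IsIntegral ℤ x' := by
    refine IsIntegral.of_pow (n := 2) (by norm_num) ?_
    rw [hx']
    exact isIntegral_algebraMap (R := ℤ) (x := m)
  have htop : Algebra.adjoin ℚ {x'} = ⊤ := by
    refine eq_top_iff.2 fun y _ => ?_
    have hy : (y : ℂ) ∈ Algebra.adjoin ℚ {w} := by
      have hw : IsAlgebraic ℚ w := (IsIntegral.of_pow (n := 2) (by norm_num)
        (by rw [hw]; simpa using isIntegral_algebraMap (R := ℚ) (A := ℂ) (x := m))).isAlgebraic
      rw [← IntermediateField.adjoin_simple_toSubalgebra_of_isAlgebraic hw, ← hle]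
      exact y.2
    obtain ⟨z, hz, hzy⟩ : ∃ z ∈ Algebra.adjoin ℚ {x'}, (z : ℂ) = y := by
      generalize (y : ℂ) = y at hy
      induction hy using Algebra.adjoin_induction with
      | mem y hy =>
        exact ⟨x', Algebra.self_mem_adjoin_singleton ℚ x', (Set.mem_singleton_iff.1 hy).symm⟩
      | algebraMap r => exact ⟨algebraMap ℚ _ r, algebraMap_mem _ r, by simp⟩
      | add y₁ y₂ _ _ h₁ h₂ =>
        obtain ⟨z₁, hz₁, rfl⟩ := h₁
        obtain ⟨z₂, hz₂, rfl⟩ := h₂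
        exact ⟨z₁ + z₂, add_mem hz₁ hz₂, rfl⟩
      | mul y₁ y₂ _ _ h₁ h₂ =>
        obtain ⟨z₁, hz₁, rfl⟩ := h₁
        obtain ⟨z₂, hz₂, rfl⟩ := h₂
        exact ⟨z₁ * z₂, mul_mem hz₁ hz₂, rfl⟩
    rwa [← Subtype.ext hzy]
  obtain ⟨x, hx⟩ := (IsIntegralClosure.isIntegral_iff (A := 𝓞 (quadraticResolvent K))).1 hint
  have := dvd_of_dvd_discr_of_sq_eq Int.prime_three (x := x) (m := m)
    (RingOfIntegers.coe_injective (by rw [map_pow, hx, hx', map_intCast]))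
    (by rw [show (x : quadraticResolvent K) = x' from hx]; convert htop) hres
  omega

/-! ### Maximality of the ring of integers -/

namespace IsCubicBasis

variable {K : Type*} [Field K] [NumberField K] {ω θ : 𝓞 K} {a b c d : ℤ}

/-- The maximality of `𝓞 K` at a root of the cubic form. -/
theorem not_dvd_of_isIntegrallyClosed (h : IsCubicBasis ω θ a b c d) {p : ℤ} (hp : Prime p)
    (hc : p ∣ c) (hbd : p ^ 2 ∣ b * d) : ¬ p ^ 3 ∣ a * d ^ 2 := by
  intro had
  have hroot := congrArg (algebraMap (𝓞 K) K) h.cubic_eq_zero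
  obtain ⟨c, rfl⟩ := hc
  obtain ⟨e, he⟩ := hbd
  obtain ⟨f, hf⟩ := had
  rw [he, hf] at hroot
  have hp0 : (p : K) ≠ 0 := by exact_mod_cast hp.ne_zero
  -- Dividing the cubic equation of θ by p³ gives a monic integral equation for θ/p. But θ cannot be
  -- p times an element of the ring, being part of a basis.
  have hint : IsIntegral ℤ ((θ : K) / p) := by
    refine ⟨Polynomial.X ^ 3 + Polynomial.C c * Polynomial.X ^ 2 + Polynomial.C e * Polynomial.X +
      Polynomial.C f, by monicity!, ?_⟩
    simp only [map_add, map_mul, map_pow, map_intCast, map_zero] at hroot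
    push_cast at hroot
    simp only [Polynomial.eval₂_add, Polynomial.eval₂_mul, Polynomial.eval₂_pow,
      Polynomial.eval₂_X, Polynomial.eval₂_C, algebraMap_int_eq, Int.coe_castRingHom]
    field_simp
    linear_combination hroot
  obtain ⟨η, hη⟩ : ∃ η : 𝓞 K, θ = p * η := by
    obtain ⟨η, hη⟩ := (IsIntegralClosure.isIntegral_iff (A := 𝓞 K)).1 hint
    refine ⟨η, RingOfIntegers.coe_injective ?_⟩
    rw [map_mul, map_intCast, hη]
    field_simp
  obtain ⟨z, x, y, rfl⟩ := h.span η
  have := h.ext (z := 0) (x := 0) (y := 1) (z' := p * z) (x' := p * x) (y' := p * y)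
    (by push_cast; linear_combination hη)
  exact hp.not_isUnit (IsUnit.of_mul_eq_one _ this.2.2.symm)

end IsCubicBasis

/-! ### Content and discriminant of the trace-zero form -/

section CubicFields

namespace IntBinaryQuadForm

theorem dvd_content_iff (Q : IntBinaryQuadForm) {n : ℤ} :
    n ∣ Q.content ↔ n ∣ Q.r ∧ n ∣ Q.s ∧ n ∣ Q.t := by
  rw [← Int.natAbs_dvd_natAbs, Int.natAbs_natCast, content, Nat.dvd_gcd_iff, Int.gcd,
    Nat.dvd_gcd_iff, Int.natAbs_dvd_natAbs, Int.natAbs_dvd_natAbs, Int.natAbs_dvd_natAbs, and_assoc]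

theorem disc_eq_content_sq_mul (Q : IntBinaryQuadForm) :
    Q.disc = Q.content ^ 2 * Q.primitive.disc := by
  obtain ⟨hr, hs, ht⟩ := Q.dvd_content_iff.1 dvd_rfl
  have hr' := Int.mul_ediv_cancel' hr
  have hs' := Int.mul_ediv_cancel' hs
  have ht' := Int.mul_ediv_cancel' ht
  simp only [disc, primitive]
  generalize Q.r / (Q.content : ℤ) = r at *
  generalize Q.s / (Q.content : ℤ) = s at *
  generalize Q.t / (Q.content : ℤ) = t at *
  rw [← hr', ← hs', ← ht']
  ring

/-- Dividing by the content removes twice its order from the discriminant. If k < 2, no further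
factor p² is available, so a lower bound j on the order of the content is already exact. -/
theorem emultiplicity_primitive_disc (Q : IntBinaryQuadForm) {p : ℤ} (hp : Prime p) {j k l : ℕ}
    (hl : emultiplicity p Q.disc = l) (hj : p ^ j ∣ Q.content)
    (hk : 2 * j + k = l) (hkj : k < 2 ∨ ¬ p ^ (j + 1) ∣ (Q.content : ℤ)) :
    emultiplicity p Q.primitive.disc = k := by
  have h := congrArg (emultiplicity p) Q.disc_eq_content_sq_mul
  rw [hl, emultiplicity_mul hp, emultiplicity_pow hp] at h
  have hj' := le_emultiplicity_of_pow_dvd hj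
  generalize emultiplicity p Q.primitive.disc = e at *
  cases e with
  | top => simp at h
  | coe e =>
    generalize hv : emultiplicity p (Q.content : ℤ) = v at *
    cases v with
    | top => simp at h
    | coe v =>
      have h1 : l = 2 * v + e := by exact_mod_cast h
      have h2 : j ≤ v := by exact_mod_cast hj'
      rcases hkj with hkj | hkj
      · norm_cast; omega
      · have : ¬ j + 1 ≤ v := fun hle => hkj (pow_dvd_of_le_emultiplicity
          (by rw [hv]; exact_mod_cast hle))
        norm_cast; omega

end IntBinaryQuadForm

variable {K : Type*} [Field K] [NumberField K]

theorem perpMap_apply (hK : finrank ℚ K = 3) (α : 𝓞 K) :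
    perpMap K α = 3 * α - (Algebra.trace ℤ (𝓞 K) α : 𝓞 K) := by
  simp [perpMap, hK]

/-- The pairing `tr (α^⊥ β^⊥)` in terms of traces on `𝓞 K`. -/
theorem trace_perpMap_mul_perpMap (hK : finrank ℚ K = 3) (α β : 𝓞 K) :
    Algebra.trace ℤ (𝓞 K) (perpMap K α * perpMap K β) =
      9 * Algebra.trace ℤ (𝓞 K) (α * β) -
        3 * (Algebra.trace ℤ (𝓞 K) α * Algebra.trace ℤ (𝓞 K) β) := by
  have h3 (n : ℤ) : Algebra.trace ℤ (𝓞 K) (n : 𝓞 K) = 3 * n := by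
    have := Algebra.trace_algebraMap (R := ℤ) (S := 𝓞 K) n
    rw [RingOfIntegers.rank, hK] at this
    simpa using this
  rw [perpMap_apply hK, perpMap_apply hK]
  generalize hs : Algebra.trace ℤ (𝓞 K) α = s
  generalize ht : Algebra.trace ℤ (𝓞 K) β = t
  rw [show (3 * α - s) * (3 * β - t) = (9 : ℤ) • (α * β) - (3 * t) • α - (3 * s) • β +
    ((s * t : ℤ) : 𝓞 K) by simp only [zsmul_eq_mul]; push_cast; ring]
  simp only [map_add, map_sub, map_zsmul, h3, hs, ht, smul_eq_mul]
  ring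

/-- Here α = tr(α)/3 is rational and integral. -/
theorem eq_intCast_of_perpMap_eq_zero (hK : finrank ℚ K = 3) {α : 𝓞 K} (h : perpMap K α = 0) :
    ∃ n : ℤ, α = n := by
  rw [perpMap_apply hK, sub_eq_zero] at h
  generalize Algebra.trace ℤ (𝓞 K) α = m at h
  have hα : (α : K) = algebraMap ℚ K ((m : ℚ) / 3) := by
    have := congrArg (algebraMap (𝓞 K) K) h
    rw [map_mul, map_ofNat, map_intCast] at this
    rw [map_div₀, eq_div_iff (by simp), mul_comm]
    simpa using this
  have hint : IsIntegral ℤ ((m : ℚ) / 3) := by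
    rw [← isIntegral_algebraMap_iff (algebraMap ℚ K).injective, ← hα]
    exact α.isIntegral_coe
  obtain ⟨k, hk⟩ := IsIntegrallyClosed.isIntegral_iff.1 hint
  refine ⟨k, RingOfIntegers.coe_injective (hα.trans ?_)⟩
  rw [← hk]
  simp

/-- A basis of `𝓞_K^⊥` lifts, together with `1`, to a basis of `𝓞_K`. -/
theorem exists_isIntBasis_perpMap_eq (hK : finrank ℚ K = 3) (b : Basis (Fin 2) ℤ (perpLattice K)) :
    ∃ ω θ : 𝓞 K, IsIntBasis ω θ ∧ perpMap K ω = b 0 ∧ perpMap K θ = b 1 := by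
  obtain ⟨ω, hω⟩ := (b 0).2
  obtain ⟨θ, hθ⟩ := (b 1).2
  have hint (n : ℤ) : perpMap K (n : 𝓞 K) = 0 := by
    have := Algebra.trace_algebraMap (R := ℤ) (S := 𝓞 K) n
    rw [RingOfIntegers.rank, hK] at this
    rw [perpMap_apply hK, show (n : 𝓞 K) = algebraMap ℤ (𝓞 K) n by simp, this]
    simp
  refine ⟨ω, θ, ⟨fun α => ?_, fun z x y e => ?_⟩, hω, hθ⟩
  · have hα := b.sum_repr ⟨perpMap K α, α, rfl⟩
    rw [Fin.sum_univ_two] at hα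
    set x := b.repr ⟨perpMap K α, α, rfl⟩ 0
    set y := b.repr ⟨perpMap K α, α, rfl⟩ 1
    have hα' := congrArg Subtype.val hα
    simp only [Submodule.coe_add, Submodule.coe_smul, ← hω, ← hθ] at hα'
    obtain ⟨z, hz⟩ := eq_intCast_of_perpMap_eq_zero hK (α := α - x • ω - y • θ)
      (by rw [map_sub, map_sub, map_smul, map_smul, ← hα']; abel)
    refine ⟨z, x, y, ?_⟩
    rw [← hz, zsmul_eq_mul, zsmul_eq_mul]
    ring
  · have hxy : x • b 0 + y • b 1 = 0 := by
      apply Subtype.ext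
      have := congrArg (perpMap K) e
      rw [← zsmul_eq_mul, ← zsmul_eq_mul, map_add, map_add, hint, map_zsmul, map_zsmul, hω, hθ,
        (perpMap K).map_zero, zero_add] at this
      exact this
    have hli := Fintype.linearIndependent_iff.1 b.linearIndependent ![x, y]
      (by simpa [Fin.sum_univ_two] using hxy)
    obtain rfl : x = 0 := hli 0
    obtain rfl : y = 0 := hli 1
    simpa using e

/-- The trace-zero form has discriminant `-108 Δ(K)`. -/
theorem disc_traceZeroForm (hK : finrank ℚ K = 3) (b : Basis (Fin 2) ℤ (perpLattice K)) :
    (IntBinaryQuadForm.ofBilin (traceZeroForm K) b).disc = -108 * discr K := by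
  obtain ⟨ω, θ, h, hω, hθ⟩ := exists_isIntBasis_perpMap_eq hK b
  have hB (i j : Fin 2) : traceZeroForm K (b i) (b j) =
    Algebra.trace ℤ (𝓞 K) ((b i : 𝓞 K) * b j) := rfl
  simp only [IntBinaryQuadForm.disc, IntBinaryQuadForm.ofBilin, hB, ← hω, ← hθ,
    trace_perpMap_mul_perpMap hK, discr_eq_of_isIntBasis h, Matrix.det_fin_three, mul_comm θ ω]
  simp
  ring

/-- Divisibility of the coefficients of the trace-zero form in terms of its values. -/
theorem dvd_of_dvd_content_traceZeroForm (hK : finrank ℚ K = 3)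
    {b : Basis (Fin 2) ℤ (perpLattice K)} {n : ℤ}
    (h : n ∣ (IntBinaryQuadForm.ofBilin (traceZeroForm K) b).content) (α : 𝓞 K) :
    n ∣ 9 * Algebra.trace ℤ (𝓞 K) (α * α) - 3 * Algebra.trace ℤ (𝓞 K) α ^ 2 := by
  obtain ⟨hr, hs, ht⟩ := (IntBinaryQuadForm.dvd_content_iff _).1 h
  have hα := b.sum_repr ⟨perpMap K α, α, rfl⟩
  rw [Fin.sum_univ_two] at hα
  have he := IntBinaryQuadForm.eval_ofBilin (traceZeroForm K) b
    (b.repr ⟨perpMap K α, α, rfl⟩ 0) (b.repr ⟨perpMap K α, α, rfl⟩ 1)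
  rw [hα] at he
  have he' : traceZeroForm K ⟨perpMap K α, α, rfl⟩ ⟨perpMap K α, α, rfl⟩ =
    Algebra.trace ℤ (𝓞 K) (perpMap K α * perpMap K α) := rfl
  rw [he', trace_perpMap_mul_perpMap hK, ← sq (Algebra.trace _ _ _)] at he
  rw [← he, IntBinaryQuadForm.eval]
  exact dvd_add (dvd_add (hr.mul_right _) (by rw [mul_assoc]; exact hs.mul_right _))
    (ht.mul_right _)

namespace IsCubicBasis

variable {ω θ : 𝓞 K} {a b c d : ℤ}

/-- The trace-zero form is a multiple of the Hessian of the cubic form of the ring of integers. -/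
theorem trace_perpMap_mul (h : IsCubicBasis ω θ a b c d) (z x y z' x' y' : ℤ) :
    Algebra.trace ℤ (𝓞 K) (perpMap K (z + x * ω + y * θ) * perpMap K (z' + x' * ω + y' * θ)) =
      6 * (b ^ 2 - 3 * a * c) * (x * x') + 3 * (b * c - 9 * a * d) * (x * y' + x' * y) +
        6 * (c ^ 2 - 3 * b * d) * (y * y') := by
  rw [trace_perpMap_mul_perpMap h.finrank_eq_three, h.trace_add, h.trace_add,
    show ((z + x * ω + y * θ) * (z' + x' * ω + y' * θ) : 𝓞 K) =
      ((z * z' : ℤ) : 𝓞 K) + (z * x' + z' * x) • ω + (z * y' + z' * y) • θ +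
      (x * x') • (ω * ω) + (x * y' + x' * y) • (ω * θ) + (y * y') • (θ * θ) by
    simp only [zsmul_eq_mul]; push_cast; ring]
  simp only [map_add, map_zsmul, h.trace_left, h.trace_right, h.trace_intCast, h.trace_sq_left,
    h.trace_sq_right, h.trace_mul, smul_eq_mul]
  ring

/-- Divisibility is proved for all values of the bilinear form, hence holds in every basis of the
lattice. -/
theorem dvd_content (h : IsCubicBasis ω θ a b c d) {n : ℤ} (h₁ : n ∣ b ^ 2 - 3 * a * c)
    (h₂ : n ∣ b * c - 9 * a * d) (h₃ : n ∣ c ^ 2 - 3 * b * d)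
    (B : Basis (Fin 2) ℤ (perpLattice K)) :
    3 * n ∣ (IntBinaryQuadForm.ofBilin (traceZeroForm K) B).content := by
  have key (u v : perpLattice K) : 3 * n ∣ traceZeroForm K u v := by
    obtain ⟨_, α, rfl⟩ := u
    obtain ⟨_, β, rfl⟩ := v
    change 3 * n ∣ Algebra.trace ℤ (𝓞 K) (perpMap K α * perpMap K β)
    obtain ⟨z, x, y, rfl⟩ := h.span α
    obtain ⟨z', x', y', rfl⟩ := h.span β
    rw [h.trace_perpMap_mul]
    obtain ⟨k₁, h₁⟩ := h₁
    obtain ⟨k₂, h₂⟩ := h₂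
    obtain ⟨k₃, h₃⟩ := h₃
    rw [h₁, h₂, h₃]
    exact ⟨2 * k₁ * (x * x') + k₂ * (x * y' + x' * y) + 2 * k₃ * (y * y'), by ring⟩
  exact (IntBinaryQuadForm.dvd_content_iff _).2 ⟨key _ _, dvd_add (key _ _) (key _ _), key _ _⟩

end IsCubicBasis

end CubicFields

/-! ### Orders at 3 in the tame and wild cases -/

namespace IsCubicBasis

variable {K : Type*} [Field K] [NumberField K] {ω θ : 𝓞 K} {a b c d : ℤ}

/-- At a simply ramified root the discriminant has order `1`, and the trace-zero form is divisible
by `3` exactly once. -/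
theorem emultiplicity_of_not_dvd (h : IsCubicBasis ω θ a b c d) (hc : 3 ∣ c) (hd : 3 ∣ d)
    (hb : ¬ 3 ∣ b) :
    emultiplicity (3 : ℤ) (discr K) = 1 ∧ ∀ B : Basis (Fin 2) ℤ (perpLattice K),
      emultiplicity (3 : ℤ) (primitiveTraceZeroForm K B).disc = 2 := by
  have hp := Int.prime_three
  have hmax := h.not_dvd_of_isIntegrallyClosed hp hc
  have hdisc := h.discr_eq
  have hD : emultiplicity (3 : ℤ) (discr K) = (1 : ℕ) := by
    obtain ⟨c, rfl⟩ := hc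
    obtain ⟨d, rfl⟩ := hd
    have hd' : ¬ 3 ∣ d := by
      rintro ⟨d, rfl⟩
      exact hmax ⟨b * d, by ring⟩ ⟨3 * a * d ^ 2, by ring⟩
    -- With c and d now divided by 3, the discriminant is -12b³d modulo 9.
    rw [emultiplicity_eq_coe, hdisc, cubicDisc]
    refine ⟨⟨3 * b ^ 2 * c ^ 2 - 36 * a * c ^ 3 - 4 * b ^ 3 * d - 81 * a ^ 2 * d ^ 2 +
        54 * a * b * c * d, by ring⟩, fun ⟨e, he⟩ => ?_⟩
    rw [show (3 : ℤ) ^ (1 + 1) = 9 by norm_num] at he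
    have : 3 ∣ b ^ 3 * d := by
      have : 4 * (b ^ 3 * d) = 3 * (b ^ 2 * c ^ 2 - 12 * a * c ^ 3 - 27 * a ^ 2 * d ^ 2 +
        18 * a * b * c * d - e) := by linarith
      omega
    rcases hp.dvd_or_dvd this with h' | h'
    · exact hb (hp.dvd_of_dvd_pow h')
    · exact hd' h'
  refine ⟨hD, fun B => ?_⟩
  refine IntBinaryQuadForm.emultiplicity_primitive_disc _ hp (j := 1) (k := 2) (l := 4) ?_ ?_ rfl
    (.inr fun h9 => ?_)
  · rw [disc_traceZeroForm h.finrank_eq_three, show (-108 : ℤ) = 3 ^ 3 * (-4) by norm_num,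
      emultiplicity_mul hp, emultiplicity_mul hp, hD, emultiplicity_pow_self_of_prime hp,
      emultiplicity_eq_zero.2 (by norm_num)]
    rfl
  · exact h.dvd_content (n := 1) (one_dvd _) (one_dvd _) (one_dvd _) B
  -- If 9 divided the content, it would divide 9 tr(ω²) - 3b², forcing 3 ∣ b.
  · have := dvd_of_dvd_content_traceZeroForm h.finrank_eq_three h9 ω
    rw [h.trace_left] at this
    exact hb (hp.dvd_of_dvd_pow (n := 2) (by omega))

/-- At a totally ramified root, if the discriminant does not have order `4`, then it has order `3` or
`5`, and the discriminant of the primitive trace-zero form is prime to `3`. -/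
theorem emultiplicity_of_dvd (h : IsCubicBasis ω θ a b c d) (hc : 3 ∣ c) (hd : 3 ∣ d)
    (hb : 3 ∣ b) (hodd : 3 ^ 4 ∣ discr K → 3 ^ 5 ∣ discr K) :
    (emultiplicity (3 : ℤ) (discr K) = 3 ∨ emultiplicity (3 : ℤ) (discr K) = 5) ∧
      ∀ B : Basis (Fin 2) ℤ (perpLattice K),
        emultiplicity (3 : ℤ) (primitiveTraceZeroForm K B).disc = 0 := by
  have hp := Int.prime_three
  have hmax := h.not_dvd_of_isIntegrallyClosed hp hc
  have hmax' := h.swap.not_dvd_of_isIntegrallyClosed hp (dvd_neg.2 hb)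
  have hdisc := h.discr_eq
  have hcontent (n : ℤ) := h.dvd_content (n := n)
  obtain ⟨b, rfl⟩ := hb
  obtain ⟨c, rfl⟩ := hc
  obtain ⟨d, rfl⟩ := hd
  have hd' : ¬ 3 ∣ d := by
    rintro ⟨d, rfl⟩
    exact hmax ⟨3 * b * d, by ring⟩ ⟨3 * a * d ^ 2, by ring⟩
  -- Maximality is applied to ω, whose cubic equation comes from the swapped form.
  have ha' : ¬ 3 ∣ a := by
    rintro ⟨a, rfl⟩
    exact hmax' ⟨c * a, by ring⟩ ⟨-(d * a ^ 2), by ring⟩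
  have h108 {m : ℕ} (hD : emultiplicity (3 : ℤ) (discr K) = m)
      (B : Basis (Fin 2) ℤ (perpLattice K)) : emultiplicity (3 : ℤ)
        (IntBinaryQuadForm.ofBilin (traceZeroForm K) B).disc = (3 + m : ℕ) := by
    rw [disc_traceZeroForm h.finrank_eq_three, show (-108 : ℤ) = 3 ^ 3 * (-4) by norm_num,
      emultiplicity_mul hp, emultiplicity_mul hp, hD, emultiplicity_pow_self_of_prime hp,
      emultiplicity_eq_zero.2 (by norm_num)]
    simp
  by_cases hc' : 3 ∣ c
  · obtain ⟨c, rfl⟩ := hc'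
    have hb' : 3 ∣ b := by
      -- Here 81 divides Δ(K), and modulo 243 it is -4·81·b³d; excluding order 4 therefore forces 3
      -- ∣ b.
      obtain ⟨e, he⟩ := hodd ⟨9 * b ^ 2 * c ^ 2 - 36 * a * c ^ 3 - 4 * b ^ 3 * d -
        3 * a ^ 2 * d ^ 2 + 18 * a * b * c * d, by rw [hdisc, cubicDisc]; ring⟩
      rw [hdisc, cubicDisc] at he
      have h3 : 3 ∣ b ^ 3 * d := by
        have : 4 * (b ^ 3 * d) = 3 * (3 * b ^ 2 * c ^ 2 - 12 * a * c ^ 3 - a ^ 2 * d ^ 2 +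
          6 * a * b * c * d - e) := by linarith
        omega
      rcases hp.dvd_or_dvd h3 with h' | h'
      · exact hp.dvd_of_dvd_pow h'
      · exact absurd h' hd'
    obtain ⟨b, rfl⟩ := hb'
    have hD : emultiplicity (3 : ℤ) (discr K) = (5 : ℕ) := by
      rw [emultiplicity_eq_coe, hdisc, cubicDisc]
      refine ⟨⟨27 * b ^ 2 * c ^ 2 - 12 * a * c ^ 3 - 36 * b ^ 3 * d -
        a ^ 2 * d ^ 2 + 18 * a * b * c * d, by ring⟩, fun ⟨e, he⟩ => ?_⟩
      rw [show (3 : ℤ) ^ (5 + 1) = 729 by norm_num] at he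
      have h3 : 3 ∣ a ^ 2 * d ^ 2 := ⟨9 * b ^ 2 * c ^ 2 - 4 * a * c ^ 3 - 12 * b ^ 3 * d +
          6 * a * b * c * d - e, by linarith⟩
      rcases hp.dvd_or_dvd h3 with h' | h'
      · exact ha' (hp.dvd_of_dvd_pow h')
      · exact hd' (hp.dvd_of_dvd_pow h')
    refine ⟨.inr hD, fun B => ?_⟩
    -- The order 3 + 5 = 8 is exhausted by a content divisible by 3·27 = 3⁴.
    exact IntBinaryQuadForm.emultiplicity_primitive_disc _ hp (j := 4) (k := 0) (h108 hD B)
      (hcontent 27 ⟨3 * b ^ 2 - a * c, by ring⟩ ⟨3 * b * c - a * d, by ring⟩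
        ⟨3 * c ^ 2 - 3 * b * d, by ring⟩ B) rfl (.inl (by norm_num))
  · have hD : emultiplicity (3 : ℤ) (discr K) = (3 : ℕ) := by
      rw [emultiplicity_eq_coe, hdisc, cubicDisc]
      refine ⟨⟨3 * b ^ 2 * c ^ 2 - 4 * a * c ^ 3 - 12 * b ^ 3 * d -
        9 * a ^ 2 * d ^ 2 + 18 * a * b * c * d, by ring⟩, fun ⟨e, he⟩ => ?_⟩
      rw [show (3 : ℤ) ^ (3 + 1) = 81 by norm_num] at he
      have h3 : 3 ∣ a * c ^ 3 := by
        have : 4 * (a * c ^ 3) = 3 * (b ^ 2 * c ^ 2 - 4 * b ^ 3 * d - 3 * a ^ 2 * d ^ 2 +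
          6 * a * b * c * d - e) := by linarith
        omega
      rcases hp.dvd_or_dvd h3 with h' | h'
      · exact ha' h'
      · exact hc' (hp.dvd_of_dvd_pow h')
    refine ⟨.inl hD, fun B => ?_⟩
    -- The order 3 + 3 = 6 is exhausted by a content divisible by 3·9 = 3³.
    exact IntBinaryQuadForm.emultiplicity_primitive_disc _ hp (j := 3) (k := 0) (h108 hD B)
      (hcontent 9 ⟨b ^ 2 - a * c, by ring⟩ ⟨b * c - 3 * a * d, by ring⟩
        ⟨c ^ 2 - 3 * b * d, by ring⟩ B) rfl (.inl (by norm_num))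

end IsCubicBasis

/-! ### Conclusion -/

theorem IsTamelyRamified.not_isWildlyRamified {K : Type*} [Field K] [NumberField K] {p : ℕ}
    (h : IsTamelyRamified K p) : ¬ IsWildlyRamified K p :=
  fun ⟨P, hP, hdvd⟩ => h.2 P hP hdvd

theorem isWildlyRamified_or_isTamelyRamified {K : Type*} [Field K] [NumberField K] {p : ℕ}
    (hp : p.Prime) (h : (p : ℤ) ∣ discr K) : IsWildlyRamified K p ∨ IsTamelyRamified K p := by
  by_cases hw : IsWildlyRamified K p
  · exact .inl hw
  · exact .inr ⟨exists_one_lt_ramificationIdx K (Nat.prime_iff_prime_int.1 hp) h,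
      fun P hP hdvd => hw ⟨P, hP, hdvd⟩⟩

theorem theoremD (K : Type*) [Field K] [NumberField K] (hK : Module.finrank ℚ K = 3)
    (hres : (3 : ℤ) ∣ NumberField.discr (quadraticResolvent K)) :
    (IsWildlyRamified K 3 ∨ IsTamelyRamified K 3) ∧
    (IsWildlyRamified K 3 ↔
      emultiplicity (3 : ℤ) (NumberField.discr K) = 3 ∨
        emultiplicity (3 : ℤ) (NumberField.discr K) = 5) ∧
    (IsTamelyRamified K 3 ↔ emultiplicity (3 : ℤ) (NumberField.discr K) = 1) ∧
    (IsWildlyRamified K 3 → ∀ b : Module.Basis (Fin 2) ℤ (perpLattice K),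
      emultiplicity (3 : ℤ) (primitiveTraceZeroForm K b).disc = 0) ∧
    (IsTamelyRamified K 3 → ∀ b : Module.Basis (Fin 2) ℤ (perpLattice K),
      emultiplicity (3 : ℤ) (primitiveTraceZeroForm K b).disc = 2) := by
  have h3 : (3 : ℤ) ∣ discr K :=
    three_dvd_of_discr_eq_sq_mul K hres (n := 1) (by ring)
  have hodd : 3 ^ 4 ∣ discr K → 3 ^ 5 ∣ discr K := by
    rintro ⟨m, hm⟩
    -- Removing the square 3⁴ = 9² does not change the resolvent field, so 3 divides the cofactor.
    obtain ⟨k, rfl⟩ := three_dvd_of_discr_eq_sq_mul K hres (n := 9) (m := m) (by rw [hm]; ring)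
    exact ⟨k, by rw [hm]; ring⟩
  have hor := isWildlyRamified_or_isTamelyRamified (K := K) Nat.prime_three h3
  have hnot := IsTamelyRamified.not_isWildlyRamified (K := K) (p := 3)
  obtain ⟨B⟩ := nonempty_basis_perpLattice K hK
  obtain ⟨ω₀, θ₀, h₀, -⟩ := exists_isIntBasis_perpMap_eq hK B
  obtain ⟨ω₁, θ₁, a₁, b₁, c₁, d₁, h₁⟩ := h₀.exists_isCubicBasis
  obtain ⟨ω, θ, a, b, c, d, h, hc, hd⟩ := h₁.exists_dvd (h₁.discr_eq ▸ h3)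
  have hwild := h.isWildlyRamified_iff hc hd
  by_cases hb : 3 ∣ b
  · obtain ⟨hD, hT⟩ := h.emultiplicity_of_dvd hc hd hb hodd
    have hw := hwild.2 hb
    refine ⟨hor, ⟨fun _ => hD, fun _ => hw⟩, ⟨fun ht => absurd hw (hnot ht), fun h1 => ?_⟩,
      fun _ => hT, fun ht => absurd hw (hnot ht)⟩
    rw [h1] at hD
    revert hD
    norm_num
  · obtain ⟨hD, hT⟩ := h.emultiplicity_of_not_dvd hc hd hb
    have hw := mt hwild.1 hb
    refine ⟨hor, ⟨fun h' => absurd h' hw, fun h' => ?_⟩,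
      ⟨fun _ => hD, fun _ => hor.resolve_left hw⟩, fun h' => absurd h' hw, fun _ => hT⟩
    rw [hD] at h'
    revert h'
    norm_num
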